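/- Work in the signature $\{\cdot,{}^{-1},1\}$ of groups. A structure for this signature is \emph{computable} if its universe is a computable set of natural numbers and its operations are computable, i.e. if its atomic diagram is computable. Among the formulas of $\mathcal{L}_{\omega_1,\omega}$, the \emph{computable $\Sigma_0$} and \emph{computable $\Pi_0$} formulas are the finitary quantifier-free ones; for $n\ge 1$, a \emph{computable $\Sigma_n$} formula is the disjunction of a c.e. set of formulas $\exists\overline{x}\,\psi$, where $\overline{x}$ is a finite tuple of variables and $\psi$ is computable $\Pi_m$ for some $m<n$; a \emph{computable $\Pi_n$} formula is the conjunction of a c.e. set of formulas $\forall\overline{x}\,\psi$, where $\psi$ is computable $\Sigma_m$ for some $m<n$ (c.e. sets of formulas being given by c.e. sets of indices). A \emph{computable d-$\Sigma_2$} sentence is the conjunction of a computable $\Sigma_2$ sentence and a computable $\Pi_2$ sentence. A \emph{pseudo-Scott sentence} for a structure $\mathcal{A}$ is a sentence of $\mathcal{L}_{\omega_1,\omega}$ whose computable models are exactly the computable isomorphic copies of $\mathcal{A}$. For a subgroup $G$ of $(\mathbb{Q},+)$ with $1\in G$ and a positive integer $m$, write $G\models m\mid 1$ if $mg=1$ for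 some $g\in G$, and put $$P^\infty(G)=\{p \text{ prime} : G\models p^k\mid 1 \text{ for all } k\},$$ $$P^{\mathrm{fin}}(G)=\{p \text{ prime} : G\models p\mid 1 \text{ and } G\not\models p^k\mid 1 \text{ for some } k\}.$$ Let $p_0=2,\ p_1=3,\ p_2=5,\dots$ be the increasing enumeration of the primes. \textbf{Lemma.} Let $X\subseteq\mathbb{N}$ be a non-computable c.e. set, and let $G\subseteq\mathbb{Q}$ be a subgroup such that $1\in G$, $P^\infty(G)=\{p_i : i\in X\}$ and $P^{\mathrm{fin}}(G)=\emptyset$. Then $G$ does not have a computable d-$\Sigma_2$ pseudo-Scott sentence. -/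

import Mathlib

namespace GroupScott

/-! ### The signature of groups -/

/-- The function symbols of the signature of groups: `1`, `⁻¹` and `·`. -/
inductive GroupFunc : ℕ → Type
  | one : GroupFunc 0
  | inv : GroupFunc 1
  | mul : GroupFunc 2

/-- The signature `{·, ⁻¹, 1}` of groups. -/
def groupLang : FirstOrder.Language.{0, 0} := ⟨GroupFunc, fun _ => Empty⟩

/-- The structure for the signature of groups given by three operations. -/
@[reducible]
def structureOfOps {M : Type*} (one : M) (inv : M → M) (mul : M → M → M) :
    groupLang.Structure M where
  funMap := fun {n} f =>
    match n, f with
    | _, GroupFunc.one => fun _ => one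
    | _, GroupFunc.inv => fun x => inv (x 0)
    | _, GroupFunc.mul => fun x => mul (x 0) (x 1)
  RelMap := fun r _ => Empty.elim r

/-- A group, seen as a structure for the signature of groups. -/
instance groupStructure (M : Type*) [Group M] : groupLang.Structure M :=
  structureOfOps 1 (fun x => x⁻¹) (fun x y => x * y)

/-- Terms of the signature of groups in the variables `x_0, …, x_{n-1}`. -/
abbrev GTerm (n : ℕ) : Type := groupLang.Term (Fin n)

def oneTerm (n : ℕ) : GTerm n :=
  FirstOrder.Language.Constants.term (L := groupLang) GroupFunc.one

def invTerm {n : ℕ} (t : GTerm n) : GTerm n :=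
  FirstOrder.Language.Functions.apply₁ (L := groupLang) GroupFunc.inv t

def mulTerm {n : ℕ} (s t : GTerm n) : GTerm n :=
  FirstOrder.Language.Functions.apply₂ (L := groupLang) GroupFunc.mul s t

/-! ### Infinitary formulas -/

/-- Formulas of `L_{ω₁,ω}` in the signature of groups whose free variables are among
`x_0, …, x_{n-1}`. Besides the finitary connectives there are conjunctions and disjunctions of
families of formulas that are indexed by an arbitrary (countable) set `S` of natural numbers.
The quantifiers bind the last variable `x_n` of a formula in `x_0, …, x_n`. -/
inductive InfFormula : ℕ → Type
  | equal {n : ℕ} (s t : GTerm n) : InfFormula n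
  | neg {n : ℕ} (φ : InfFormula n) : InfFormula n
  | and {n : ℕ} (φ ψ : InfFormula n) : InfFormula n
  | or {n : ℕ} (φ ψ : InfFormula n) : InfFormula n
  | conj {n : ℕ} (S : Set ℕ) (f : S → InfFormula n) : InfFormula n
  | disj {n : ℕ} (S : Set ℕ) (f : S → InfFormula n) : InfFormula n
  | all {n : ℕ} (φ : InfFormula (n + 1)) : InfFormula n
  | ex {n : ℕ} (φ : InfFormula (n + 1)) : InfFormula n

namespace InfFormula

/-- Truth of a formula in a structure, under an assignment of its free variables. -/
def Realize {M : Type*} [groupLang.Structure M] : {n : ℕ} → InfFormula n → (Fin n → M) → Prop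
  | _, equal s t, v => s.realize v = t.realize v
  | _, neg φ, v => ¬ φ.Realize v
  | _, and φ ψ, v => φ.Realize v ∧ ψ.Realize v
  | _, or φ ψ, v => φ.Realize v ∨ ψ.Realize v
  | _, conj S f, v => ∀ i : S, (f i).Realize v
  | _, disj S f, v => ∃ i : S, (f i).Realize v
  | _, all φ, v => ∀ a : M, φ.Realize (Fin.snoc v a)
  | _, ex φ, v => ∃ a : M, φ.Realize (Fin.snoc v a)

/-- Existential quantification over the tuple of the last `m` variables. -/
def exs {n : ℕ} : (m : ℕ) → InfFormula (n + m) → InfFormula n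
  | 0, φ => φ
  | m + 1, φ => exs m (ex φ)

/-- Universal quantification over the tuple of the last `m` variables. -/
def alls {n : ℕ} : (m : ℕ) → InfFormula (n + m) → InfFormula n
  | 0, φ => φ
  | m + 1, φ => alls m (all φ)

end InfFormula

/-- A sentence of `L_{ω₁,ω}` is a formula without free variables. -/
abbrev InfSentence : Type := InfFormula 0

/-- The sentence `φ` is true in the structure `M`. -/
def Models (M : Type*) [groupLang.Structure M] (φ : InfSentence) : Prop :=
  φ.Realize (Fin.elim0 : Fin 0 → M)

/-! ### Computable formulas -/

/-- The standard numbering `W_0, W_1, …` of the c.e. sets: `W e` is the domain of the `e`-th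
partial computable function. -/
def W (e : ℕ) : Set ℕ :=
  {x | ((Denumerable.ofNat Nat.Partrec.Code e).eval x).Dom}

/-- An effective numbering of all terms in `x_0, …, x_{n-1}`: `0` codes `1`; a number `c + 1` codes
a variable, an inverse or a product according to the residue of `c` modulo `3`. (A code of a
variable that is not available is read as `1`.) -/
def decodeTerm (n : ℕ) : ℕ → GTerm n
  | 0 => oneTerm n
  | c + 1 =>
    have h0 : c / 3 < c + 1 := Nat.lt_succ_of_le (Nat.div_le_self c 3)
    have h1 : (c / 3).unpair.1 < c + 1 := lt_of_le_of_lt (Nat.unpair_left_le _) h0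
    have h2 : (c / 3).unpair.2 < c + 1 := lt_of_le_of_lt (Nat.unpair_right_le _) h0
    match c % 3 with
    | 0 => if h : c / 3 < n then FirstOrder.Language.Term.var ⟨c / 3, h⟩ else oneTerm n
    | 1 => invTerm (decodeTerm n (c / 3))
    | _ => mulTerm (decodeTerm n (c / 3).unpair.1) (decodeTerm n (c / 3).unpair.2)
termination_by c => c

/-- An effective numbering of all finitary quantifier-free formulas in `x_0, …, x_{n-1}`: `0` codes
`1 = 1`; a number `c + 1` codes an equation, a negation, a conjunction or a disjunction according
to the residue of `c` modulo `4`. -/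
def decodeQF (n : ℕ) : ℕ → InfFormula n
  | 0 => .equal (oneTerm n) (oneTerm n)
  | c + 1 =>
    have h0 : c / 4 < c + 1 := Nat.lt_succ_of_le (Nat.div_le_self c 4)
    have h1 : (c / 4).unpair.1 < c + 1 := lt_of_le_of_lt (Nat.unpair_left_le _) h0
    have h2 : (c / 4).unpair.2 < c + 1 := lt_of_le_of_lt (Nat.unpair_right_le _) h0
    match c % 4 with
    | 0 => .equal (decodeTerm n (c / 4).unpair.1) (decodeTerm n (c / 4).unpair.2)
    | 1 => .neg (decodeQF n (c / 4))
    | 2 => .and (decodeQF n (c / 4).unpair.1) (decodeQF n (c / 4).unpair.2)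
    | _ => .or (decodeQF n (c / 4).unpair.1) (decodeQF n (c / 4).unpair.2)
termination_by c => c

/-- A number `i = ⟨b, ⟨m, j⟩⟩` is read as a triple: a level `b`, the length `m` of a tuple of
variables, and an index `j`. -/
def level (i : ℕ) : ℕ := i.unpair.1

def tupleLength (i : ℕ) : ℕ := i.unpair.2.unpair.1

def subIndex (i : ℕ) : ℕ := i.unpair.2.unpair.2

mutual

/-- The computable `Σ_k` formula with index `e` in `x_0, …, x_{n-1}`. For `k = 0` it is the finitary
quantifier-free formula with code `e`; for `k > 0` it is the disjunction, over the triples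
`⟨b, ⟨m, j⟩⟩` in the c.e. set `W e` with `b < k`, of the formulas `∃ x_n … x_{n+m-1}, ψ`, where `ψ` is
the computable `Π_b` formula with index `j` in `x_0, …, x_{n+m-1}`. -/
def sigmaFormula : (k n e : ℕ) → InfFormula n
  | 0, n, e => decodeQF n e
  | k + 1, n, e =>
    .disj {i | i ∈ W e ∧ level i < k + 1} fun i =>
      .exs (tupleLength i) (piFormula (level i) (n + tupleLength i) (subIndex i))
termination_by k => k
decreasing_by exact i.2.2

/-- The computable `Π_k` formula with index `e` in `x_0, …, x_{n-1}`; dual to `sigmaFormula`. -/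
def piFormula : (k n e : ℕ) → InfFormula n
  | 0, n, e => decodeQF n e
  | k + 1, n, e =>
    .conj {i | i ∈ W e ∧ level i < k + 1} fun i =>
      .alls (tupleLength i) (sigmaFormula (level i) (n + tupleLength i) (subIndex i))
termination_by k => k
decreasing_by exact i.2.2

end

/-- The computable `Σ_k` sentences. -/
def IsComputableSigma (k : ℕ) (φ : InfSentence) : Prop := ∃ e, φ = sigmaFormula k 0 e

/-- The computable `Π_k` sentences. -/
def IsComputablePi (k : ℕ) (φ : InfSentence) : Prop := ∃ e, φ = piFormula k 0 e

/-- The computable d-`Σ_k` sentences: the conjunctions of a computable `Σ_k` sentence and a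
computable `Π_k` sentence. -/
def IsComputableDSigma (k : ℕ) (φ : InfSentence) : Prop :=
  ∃ σ π : InfSentence, IsComputableSigma k σ ∧ IsComputablePi k π ∧ φ = .and σ π

/-! ### Computable structures and pseudo-Scott sentences -/

/-- A computable structure for the signature of groups: the universe is a computable set of natural
numbers and the operations are (restrictions to the universe of) computable functions.
The group axioms are not required. -/
structure ComputableStructure where
  carrier : Set ℕ
  one : ℕ
  inv : ℕ → ℕ
  mul : ℕ → ℕ → ℕ
  one_mem : one ∈ carrier
  inv_mem : ∀ a ∈ carrier, inv a ∈ carrier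
  mul_mem : ∀ a ∈ carrier, ∀ b ∈ carrier, mul a b ∈ carrier
  computable_carrier : ComputablePred fun a => a ∈ carrier
  computable_inv : Computable inv
  computable_mul : Computable₂ mul

/-- The universe of a computable structure, as a type. -/
abbrev ComputableStructure.Universe (B : ComputableStructure) : Type := {a : ℕ // a ∈ B.carrier}

instance (B : ComputableStructure) : groupLang.Structure B.Universe :=
  structureOfOps ⟨B.one, B.one_mem⟩ (fun a => ⟨B.inv a.1, B.inv_mem _ a.2⟩)
    (fun a b => ⟨B.mul a.1 b.1, B.mul_mem _ a.2 _ b.2⟩)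

/-- `φ` is a pseudo-Scott sentence for `A`: its computable models are exactly the computable
structures that are isomorphic to `A`. -/
def IsPseudoScottSentence (A : Type*) [groupLang.Structure A] (φ : InfSentence) : Prop :=
  ∀ B : ComputableStructure,
    Models B.Universe φ ↔ Nonempty (groupLang.Equiv B.Universe A)

/-! ### Subgroups of the rational numbers -/

/-- `m ∣ 1` in the subgroup `G` of `ℚ`. -/
def DividesOne (G : AddSubgroup ℚ) (m : ℕ) : Prop := ∃ g ∈ G, m • g = 1

/-- `P^∞(G)`: the primes `p` such that `p ^ k ∣ 1` in `G` for all `k`. -/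
def PInf (G : AddSubgroup ℚ) : Set ℕ :=
  {p | p.Prime ∧ ∀ k : ℕ, DividesOne G (p ^ k)}

/-- `P^fin(G)`: the primes `p` such that `p ∣ 1` in `G`, but `p ^ k ∤ 1` in `G` for some `k`. -/
def PFin (G : AddSubgroup ℚ) : Set ℕ :=
  {p | p.Prime ∧ DividesOne G p ∧ ∃ k : ℕ, ¬ DividesOne G (p ^ k)}

end GroupScott

open FirstOrder

namespace GroupScott

-- Suppose `σ ∧ π` is a pseudo-Scott sentence for `G`, with `σ` computable `Σ_2` and `π` computable
-- `Π_2`. Up to equality, `G` is the group of fractions whose denominators are products of primes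
-- `p_i` with `i ∈ X` (`eq_fractions`). These primes can be enumerated, so `G` has a computable copy
-- (`exists_computable_copy_fractions`), and therefore `G` satisfies `σ` and `π`.
--
-- For each `i` let `H_i` be `G` with `p_i` inverted. It also has a computable copy. If `i ∈ X` then
-- `H_i = G`; if `i ∉ X` then `H_i` is not isomorphic to `G` (`mem_PInf_of_equiv`). So it suffices
-- to find `i ∉ X` with `H_i ⊨ σ ∧ π`.
--
-- The sentence `π` holds in every `H_i`: this group is the increasing union of the copies `p_i^{-k}
-- G` of `G`, and `Π_2` sentences pass to such unions (`models_piFormula_two`, `exists_eq_divPow`).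
--
-- For `σ`, fix a disjunct and a witness `c` in `G`; the essential case is a `Π_1` matrix `ψ(c)`.
-- Its failure in `H_i` is c.e. uniformly in `i` (`exists_refutes_iff`, `computable_refutes`), and
-- it never fails for `i ∈ X`. If it failed for all `i ∉ X`, the complement of `X` would be c.e. and
-- `X` computable. Hence `ψ(c)`, and with it `σ`, survives in `H_i` for some `i ∉ X`.

theorem append_snoc {α : Type*} {n m : ℕ} (v : Fin n → α) (w : Fin m → α) (a : α) :
    Fin.append v (Fin.snoc w a : Fin (m + 1) → α) =
      (Fin.snoc (Fin.append v w) a : Fin (n + m + 1) → α) := by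
  funext i
  refine Fin.addCases (fun i => ?_) (fun i => ?_) i
  · rw [Fin.append_left]
    have : Fin.castAdd (m + 1) i = (Fin.castAdd m i).castSucc := rfl
    rw [this, Fin.snoc_castSucc (α := fun _ => α), Fin.append_left]
  · rw [Fin.append_right]
    refine Fin.lastCases ?_ (fun i => ?_) i
    · have : Fin.natAdd n (Fin.last m) = Fin.last (n + m) := rfl
      rw [this, Fin.snoc_last (α := fun _ => α), Fin.snoc_last (α := fun _ => α)]
    · have : Fin.natAdd n i.castSucc = (Fin.natAdd n i).castSucc := rfl
      rw [this, Fin.snoc_castSucc (α := fun _ => α), Fin.snoc_castSucc (α := fun _ => α),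
        Fin.append_right]

-- Truth of computable formulas under isomorphisms, embeddings and unions.

section Semantics

variable {M N : Type*} [groupLang.Structure M] [groupLang.Structure N]

theorem realize_exs {n : ℕ} (m : ℕ) (φ : InfFormula (n + m)) (v : Fin n → M) :
    (φ.exs m).Realize v ↔ ∃ w : Fin m → M, φ.Realize (Fin.append v w) := by
  induction m with
  | zero =>
    have h : ∀ w : Fin 0 → M, Fin.append v w = v := fun w => by
      rw [Subsingleton.elim w Fin.elim0, Fin.append_elim0]; rfl
    simp [InfFormula.exs, h]
  | succ m ih =>
    rw [InfFormula.exs, ih]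
    simp only [InfFormula.Realize]
    constructor
    · rintro ⟨w, a, h⟩
      exact ⟨Fin.snoc w a, by rwa [append_snoc]⟩
    · rintro ⟨w, h⟩
      refine ⟨Fin.init w, w (Fin.last m), ?_⟩
      rw [← append_snoc, Fin.snoc_init_self]
      exact h

theorem realize_alls {n : ℕ} (m : ℕ) (φ : InfFormula (n + m)) (v : Fin n → M) :
    (φ.alls m).Realize v ↔ ∀ w : Fin m → M, φ.Realize (Fin.append v w) := by
  induction m with
  | zero =>
    have h : ∀ w : Fin 0 → M, Fin.append v w = v := fun w => by
      rw [Subsingleton.elim w Fin.elim0, Fin.append_elim0]; rfl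
    simp [InfFormula.alls, h]
  | succ m ih =>
    rw [InfFormula.alls, ih]
    simp only [InfFormula.Realize]
    constructor
    · intro h w
      have := h (Fin.init w) (w (Fin.last m))
      rwa [← append_snoc, Fin.snoc_init_self] at this
    · intro h w a
      rw [← append_snoc]
      exact h _

theorem realize_sigmaFormula_succ (k n e : ℕ) (v : Fin n → M) :
    (sigmaFormula (k + 1) n e).Realize v ↔ ∃ i ∈ W e, level i < k + 1 ∧
      ∃ w : Fin (tupleLength i) → M,
        (piFormula (level i) (n + tupleLength i) (subIndex i)).Realize (Fin.append v w) := by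
  rw [sigmaFormula]
  simp only [InfFormula.Realize, realize_exs, Subtype.exists, Set.mem_ofPred_eq, exists_prop,
    and_assoc]

theorem realize_piFormula_succ (k n e : ℕ) (v : Fin n → M) :
    (piFormula (k + 1) n e).Realize v ↔ ∀ i ∈ W e, level i < k + 1 →
      ∀ w : Fin (tupleLength i) → M,
        (sigmaFormula (level i) (n + tupleLength i) (subIndex i)).Realize (Fin.append v w) := by
  rw [piFormula]
  simp only [InfFormula.Realize, realize_alls, Subtype.forall, Set.mem_ofPred_eq, and_imp]

theorem sigmaFormula_zero (n e : ℕ) : sigmaFormula 0 n e = decodeQF n e := by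
  rw [sigmaFormula]

theorem piFormula_zero (n e : ℕ) : piFormula 0 n e = decodeQF n e := by
  rw [piFormula]

theorem realize_equiv (e : M ≃[groupLang] N) {n : ℕ} (φ : InfFormula n) (v : Fin n → M) :
    φ.Realize (e ∘ v) ↔ φ.Realize v := by
  induction φ with
  | equal s t => simp [InfFormula.Realize, Language.HomClass.realize_term]
  | neg φ ih => simp only [InfFormula.Realize, ih]
  | and φ ψ ih₁ ih₂ => simp only [InfFormula.Realize, ih₁, ih₂]
  | or φ ψ ih₁ ih₂ => simp only [InfFormula.Realize, ih₁, ih₂]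
  | conj S f ih => simp only [InfFormula.Realize, ih]
  | disj S f ih => simp only [InfFormula.Realize, ih]
  | all φ ih =>
    simp only [InfFormula.Realize]
    rw [← e.toEquiv.forall_congr_right]
    refine forall_congr' fun a => ?_
    rw [← ih, Fin.comp_snoc]
    rfl
  | ex φ ih =>
    simp only [InfFormula.Realize]
    rw [← e.toEquiv.exists_congr_right]
    refine exists_congr fun a => ?_
    rw [← ih, Fin.comp_snoc]
    rfl

theorem models_of_equiv (e : M ≃[groupLang] N) {φ : InfSentence} (h : Models M φ) :
    Models N φ := by
  have := (realize_equiv e φ Fin.elim0).2 h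
  rwa [Subsingleton.elim (e ∘ (Fin.elim0 : Fin 0 → M)) Fin.elim0] at this

theorem realize_decodeQF_embedding (f : M ↪[groupLang] N) (n : ℕ) (v : Fin n → M) (c : ℕ) :
    (decodeQF n c).Realize (f ∘ v) ↔ (decodeQF n c).Realize v := by
  induction c using Nat.strong_induction_on with
  | _ c ih =>
    cases c with
    | zero =>
      rw [decodeQF]
      simp [InfFormula.Realize]
    | succ c =>
      have h0 : c / 4 < c + 1 := Nat.lt_succ_of_le (Nat.div_le_self c 4)
      have h1 := ih _ (lt_of_le_of_lt (Nat.unpair_left_le _) h0)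
      have h2 := ih _ (lt_of_le_of_lt (Nat.unpair_right_le _) h0)
      rw [decodeQF]
      split
      · simp [InfFormula.Realize, Language.HomClass.realize_term]
      · simp only [InfFormula.Realize, ih _ h0]
      · simp only [InfFormula.Realize, h1, h2]
      · simp only [InfFormula.Realize, h1, h2]

theorem append_comp {α β : Type*} (f : α → β) {n m : ℕ} (v : Fin n → α) (w : Fin m → α) :
    Fin.append (f ∘ v) (f ∘ w) = f ∘ Fin.append v w := by
  ext i
  refine Fin.addCases (fun i => ?_) (fun i => ?_) i <;> simp

/-- Computable `Σ_0` and `Σ_1` formulas are preserved by embeddings. -/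
theorem realize_sigmaFormula_embedding (f : M ↪[groupLang] N) {k : ℕ} (hk : k < 2) (n e : ℕ)
    (v : Fin n → M) (h : (sigmaFormula k n e).Realize v) :
    (sigmaFormula k n e).Realize (f ∘ v) := by
  obtain rfl | rfl : k = 0 ∨ k = 1 := by omega
  · rw [sigmaFormula_zero] at h ⊢
    exact (realize_decodeQF_embedding f n v e).2 h
  · rw [realize_sigmaFormula_succ] at h ⊢
    obtain ⟨i, hi, hl, w, hw⟩ := h
    refine ⟨i, hi, hl, f ∘ w, ?_⟩
    have hl0 : level i = 0 := by omega
    rw [hl0, piFormula_zero] at hw ⊢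
    rw [append_comp, realize_decodeQF_embedding]
    exact hw

/-- Computable `Π_2` sentences pass from `M` to any structure whose finite tuples are all contained
in embedded copies of `M`. -/
theorem models_piFormula_two {ι : Type*} (f : ι → M ↪[groupLang] N)
    (hf : ∀ (n : ℕ) (v : Fin n → N), ∃ (k : ι) (u : Fin n → M), v = f k ∘ u) (e : ℕ)
    (h : Models M (piFormula 2 0 e)) : Models N (piFormula 2 0 e) := by
  unfold Models at h ⊢
  rw [realize_piFormula_succ] at h ⊢
  intro i hi hl w
  -- The universally quantified tuple is pulled back to `M`, where the `Σ_1` instance holds; its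
  -- witnesses are pushed forward along the same embedding.
  obtain ⟨k, u, rfl⟩ := hf _ w
  have := realize_sigmaFormula_embedding (f k) hl _ _ _ (h i hi hl u)
  rwa [← append_comp, Subsingleton.elim (f k ∘ (Fin.elim0 : Fin 0 → M)) Fin.elim0] at this

end Semantics

/-- An injective homomorphism of additive groups, as an embedding of structures. -/
def embeddingOfAddHom {A B : Type*} [AddGroup A] [AddGroup B] (f : A →+ B)
    (hf : Function.Injective f) : Multiplicative A ↪[groupLang] Multiplicative B where
  toFun x := Multiplicative.ofAdd (f x.toAdd)
  inj' := fun x y h => hf h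
  map_fun' := by
    intro n F x
    cases F
    · exact map_zero f
    · exact map_neg f _
    · exact map_add f _ _
  map_rel' := fun r => Empty.elim r

/-! ### Computability of primes and of projections -/

/-- Unbounded search for `t` halts exactly when a solution exists. -/
theorem REPred.exists_nat {α : Type*} [Primcodable α] {p : α → ℕ → Bool} (hp : Computable₂ p) :
    REPred fun a => ∃ t, p a t = true := by
  have h : Partrec fun a => Nat.rfind (fun t => Part.some (p a t)) := Partrec.rfind hp
  refine (Partrec.dom_re h).of_eq fun a => ?_
  refine Nat.rfind_dom.trans ?_
  constructor
  · rintro ⟨n, hn, -⟩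
    exact ⟨n, by simpa using hn⟩
  · rintro ⟨n, hn⟩
    exact ⟨n, by simpa using hn.symm, fun _ => trivial⟩

/-- The least solution of a computable, always solvable, condition is computable. -/
theorem computable_of_isLeast {α : Type*} [Primcodable α] {p : α → ℕ → Bool}
    (hp : Computable₂ p) {f : α → ℕ} (hf : ∀ a, p a (f a) = true)
    (hmin : ∀ a t, p a t = true → f a ≤ t) : Computable f := by
  have h : Partrec fun a => Nat.rfind (fun t => Part.some (p a t)) := Partrec.rfind hp
  refine h.of_eq fun a => ?_
  refine Part.eq_some_iff.2 (Nat.mem_rfind.2 ⟨by simpa using (hf a).symm, fun {m} hm => ?_⟩)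
  rw [Part.mem_some_iff, eq_comm, ← Bool.not_eq_true]
  exact fun h => absurd (hmin a m h) (not_le.2 hm)

theorem primrecPred_prime : PrimrecPred Nat.Prime := by
  have hR : PrimrecRel fun x n : ℕ => x < 2 ∨ ¬ n % x = 0 :=
    (Primrec.nat_lt.comp .fst (.const 2)).or
      ((Primrec.eq.comp (Primrec.nat_mod.comp .snd .fst) (.const 0)).not)
  have h : PrimrecPred fun n : ℕ => 2 ≤ n ∧ ∀ x < n, x < 2 ∨ ¬ n % x = 0 :=
    (Primrec.nat_le.comp (.const 2) .id).and ((hR.forall_lt).comp .id .id)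
  refine h.of_eq fun n => ?_
  rw [Nat.prime_def_lt']
  refine and_congr_right fun _ => forall_congr' fun x => ?_
  rw [Nat.dvd_iff_mod_eq_zero]
  constructor
  · intro h h2 hx
    exact (h hx).resolve_left (by omega)
  · intro h hx
    by_cases h2 : x < 2
    · exact .inl h2
    · exact .inr (h (by omega) hx)

theorem computable_nthPrime : Computable (Nat.nth Nat.Prime) := by
  -- There are `count (x + 1)` primes up to `x`, so this is the least prime above `x`; iterating
  -- from `2` enumerates the primes.
  have hstep : Computable fun x : ℕ => Nat.nth Nat.Prime (Nat.count Nat.Prime (x + 1)) := by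
    have hP : Primrec fun n : ℕ => decide (Nat.Prime n) := primrecPred_prime.decide
    have hp : Computable₂ fun x t : ℕ => decide (x < t) && decide (Nat.Prime t) := by
      have h1 : Primrec₂ fun x t : ℕ => decide (x < t) := Primrec.nat_lt.decide
      exact (Primrec.and.comp h1 (hP.comp .snd)).to_comp
    refine computable_of_isLeast hp (fun x => ?_) fun x t ht => ?_
    · have h1 := Nat.prime_nth_prime (Nat.count Nat.Prime (x + 1))
      have h2 : x + 1 ≤ Nat.nth Nat.Prime (Nat.count Nat.Prime (x + 1)) :=
        Nat.le_nth_count Nat.infinite_setOfPred_prime _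
      simp only [Bool.and_eq_true, decide_eq_true_eq]
      exact ⟨by omega, h1⟩
    · simp only [Bool.and_eq_true, decide_eq_true_eq] at ht
      rw [Nat.nth_count_eq_sInf]
      exact Nat.sInf_le ⟨ht.2, ht.1⟩
  refine (Computable.nat_rec (f := id) (g := fun _ => 2)
    (h := fun _ (q : ℕ × ℕ) => Nat.nth Nat.Prime (Nat.count Nat.Prime (q.2 + 1)))
    .id (.const 2) (hstep.comp (Computable.snd.comp .snd))).of_eq fun n => ?_
  induction n with
  | zero => simp
  | succ n ih =>
    simp only [id_eq] at ih ⊢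
    simp only [ih]
    rw [Nat.count_succ, if_pos (Nat.prime_nth_prime n),
      Nat.count_nth_of_infinite Nat.infinite_setOfPred_prime]

/-! ### Evaluation of quantifier-free formulas at tuples of integers -/

/-- The integer `a - b` represented by the pair `(a, b)`. -/
def pairToInt (p : ℕ × ℕ) : ℤ := p.1 - p.2

/-- The value of the term with code `c` when its variables have the values in the list `l`, where
integers are represented by pairs. -/
def termValue (l : List (ℕ × ℕ)) : ℕ → ℕ × ℕ
  | 0 => (0, 0)
  | c + 1 =>
    have h0 : c / 3 < c + 1 := Nat.lt_succ_of_le (Nat.div_le_self c 3)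
    have _h1 : (c / 3).unpair.1 < c + 1 := lt_of_le_of_lt (Nat.unpair_left_le _) h0
    have _h2 : (c / 3).unpair.2 < c + 1 := lt_of_le_of_lt (Nat.unpair_right_le _) h0
    bif c % 3 == 0 then l.getD (c / 3) (0, 0)
    else bif c % 3 == 1 then (termValue l (c / 3)).swap
    else termValue l (c / 3).unpair.1 + termValue l (c / 3).unpair.2
termination_by c => c

/-- The truth value of the quantifier-free formula with code `c` when its variables have the values
in the list `l`, where integers are represented by pairs. -/
def evalQF (l : List (ℕ × ℕ)) : ℕ → Bool
  | 0 => true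
  | c + 1 =>
    have h0 : c / 4 < c + 1 := Nat.lt_succ_of_le (Nat.div_le_self c 4)
    have _h1 : (c / 4).unpair.1 < c + 1 := lt_of_le_of_lt (Nat.unpair_left_le _) h0
    have _h2 : (c / 4).unpair.2 < c + 1 := lt_of_le_of_lt (Nat.unpair_right_le _) h0
    bif c % 4 == 0 then
      decide ((termValue l (c / 4).unpair.1).1 + (termValue l (c / 4).unpair.2).2 =
        (termValue l (c / 4).unpair.2).1 + (termValue l (c / 4).unpair.1).2)
    else bif c % 4 == 1 then !(evalQF l (c / 4))
    else bif c % 4 == 2 then evalQF l (c / 4).unpair.1 && evalQF l (c / 4).unpair.2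
    else evalQF l (c / 4).unpair.1 || evalQF l (c / 4).unpair.2
termination_by c => c

theorem realize_oneTerm {M : Type*} [Group M] (n : ℕ) (v : Fin n → M) :
    (oneTerm n).realize v = 1 := rfl

theorem realize_invTerm {M : Type*} [Group M] {n : ℕ} (t : GTerm n) (v : Fin n → M) :
    (invTerm t).realize v = (t.realize v)⁻¹ := rfl

theorem realize_mulTerm {M : Type*} [Group M] {n : ℕ} (s t : GTerm n) (v : Fin n → M) :
    (mulTerm s t).realize v = s.realize v * t.realize v := rfl

theorem realize_decodeTerm {n : ℕ} {l : List (ℕ × ℕ)} (hl : l.length = n) (c : ℕ) :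
    (decodeTerm n c).realize
        (fun i : Fin n => Multiplicative.ofAdd (pairToInt (l.getD i (0, 0)))) =
      Multiplicative.ofAdd (pairToInt (termValue l c)) := by
  induction c using Nat.strong_induction_on with
  | _ c ih =>
    cases c with
    | zero =>
      rw [decodeTerm, termValue, realize_oneTerm]
      rfl
    | succ c =>
      have h0 : c / 3 < c + 1 := Nat.lt_succ_of_le (Nat.div_le_self c 3)
      have h1 := ih _ (lt_of_le_of_lt (Nat.unpair_left_le _) h0)
      have h2 := ih _ (lt_of_le_of_lt (Nat.unpair_right_le _) h0)
      rw [decodeTerm, termValue]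
      split
      · rename_i h
        simp only [h, beq_self_eq_true, cond_true]
        split
        · rfl
        -- An unavailable variable is read as `1` on one side and as the default `(0, 0)`, that is
        -- zero, on the other; they agree because `l` has length exactly `n`.
        · rw [realize_oneTerm, List.getD_eq_default _ _ (by omega)]
          rfl
      · rename_i h
        simp only [h, Nat.reduceBEq, cond_false, cond_true]
        rw [realize_invTerm, ih _ h0, ← ofAdd_neg]
        simp [pairToInt]
      · rename_i h3 h4
        have e1 : (c % 3 == 0) = false := by simpa using h3
        have e2 : (c % 3 == 1) = false := by simpa using h4
        simp only [e1, e2, cond_false]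
        rw [realize_mulTerm, h1, h2, ← ofAdd_add]
        congr 1
        simp only [pairToInt, Prod.fst_add, Prod.snd_add]
        push_cast
        ring

theorem realize_decodeQF {n : ℕ} {l : List (ℕ × ℕ)} (hl : l.length = n) (c : ℕ) :
    (decodeQF n c).Realize
        (fun i : Fin n => Multiplicative.ofAdd (pairToInt (l.getD i (0, 0)))) ↔
      evalQF l c = true := by
  induction c using Nat.strong_induction_on with
  | _ c ih =>
    cases c with
    | zero =>
      rw [decodeQF, evalQF]
      simp [InfFormula.Realize]
    | succ c =>
      have h0 : c / 4 < c + 1 := Nat.lt_succ_of_le (Nat.div_le_self c 4)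
      have h1 := ih _ (lt_of_le_of_lt (Nat.unpair_left_le _) h0)
      have h2 := ih _ (lt_of_le_of_lt (Nat.unpair_right_le _) h0)
      rw [decodeQF, evalQF]
      split
      · rename_i h
        simp only [h, beq_self_eq_true, cond_true, InfFormula.Realize, realize_decodeTerm hl]
        rw [Multiplicative.ofAdd.injective.eq_iff, decide_eq_true_eq]
        unfold pairToInt
        omega
      · rename_i h
        simp only [h, Nat.reduceBEq, cond_false, cond_true, InfFormula.Realize, ih _ h0]
        simp
      · rename_i h
        simp only [h, Nat.reduceBEq, cond_false, cond_true, InfFormula.Realize, h1, h2]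
        simp
      · rename_i h3 h4 h5
        have e1 : (c % 4 == 0) = false := by simpa using h3
        have e2 : (c % 4 == 1) = false := by simpa using h4
        have e3 : (c % 4 == 2) = false := by simpa using h5
        simp only [e1, e2, e3, cond_false, InfFormula.Realize, h1, h2]
        simp

theorem primrec_pairAdd : Primrec₂ fun p q : ℕ × ℕ => p + q :=
  Primrec.pair (Primrec.nat_add.comp (Primrec.fst.comp .fst) (Primrec.fst.comp .snd))
    (Primrec.nat_add.comp (Primrec.snd.comp .fst) (Primrec.snd.comp .snd))

theorem primrec_pairSwap : Primrec fun p : ℕ × ℕ => p.swap := Primrec.pair .snd .fst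

/-- Course-of-values recursion: the table `t` lists the values at all smaller codes, so its length
is the current code and each recursive call is a lookup. -/
theorem primrec_termValue : Primrec₂ termValue := by
  let step (l : List (ℕ × ℕ)) (t : List (ℕ × ℕ)) (c : ℕ) : ℕ × ℕ :=
    bif c % 3 == 0 then l.getD (c / 3) (0, 0)
    else bif c % 3 == 1 then (t.getD (c / 3) (0, 0)).swap
    else t.getD (c / 3).unpair.1 (0, 0) + t.getD (c / 3).unpair.2 (0, 0)
  have hstep : Primrec fun a : (List (ℕ × ℕ) × List (ℕ × ℕ)) × ℕ => step a.1.1 a.1.2 a.2 := by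
    have hm : ∀ k : ℕ, Primrec fun a : (List (ℕ × ℕ) × List (ℕ × ℕ)) × ℕ => a.2 % 3 == k :=
      fun k => Primrec.beq.comp (Primrec.nat_mod.comp .snd (.const 3)) (.const k)
    have hd : Primrec fun a : (List (ℕ × ℕ) × List (ℕ × ℕ)) × ℕ => a.2 / 3 :=
      Primrec.nat_div.comp .snd (.const 3)
    have hu := Primrec.unpair.comp hd
    have hl : Primrec fun a : (List (ℕ × ℕ) × List (ℕ × ℕ)) × ℕ => a.1.1 := Primrec.fst.comp .fst
    have ht : Primrec fun a : (List (ℕ × ℕ) × List (ℕ × ℕ)) × ℕ => a.1.2 := Primrec.snd.comp .fst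
    have hg := Primrec.list_getD ((0, 0) : ℕ × ℕ)
    exact Primrec.cond (hm 0) (hg.comp hl hd) (Primrec.cond (hm 1)
      (primrec_pairSwap.comp (hg.comp ht hd))
      (primrec_pairAdd.comp (hg.comp ht (Primrec.fst.comp hu)) (hg.comp ht (Primrec.snd.comp hu))))
  refine Primrec.nat_strong_rec termValue
    (g := fun l t => some (Nat.casesOn t.length (0, 0) fun c => step l t c)) ?_ ?_
  · refine Primrec.option_some.comp (Primrec.nat_casesOn (Primrec.list_length.comp .snd)
      (.const (0, 0)) ?_)
    exact hstep
  · intro l n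
    have hget : ∀ m < n, ((List.range n).map (termValue l)).getD m (0, 0) = termValue l m := by
      intro m hm
      simp [List.getD, hm]
    cases n with
    | zero => simp [termValue]
    | succ c =>
      have h0 : c / 3 < c + 1 := Nat.lt_succ_of_le (Nat.div_le_self c 3)
      have h1 := hget _ (lt_of_le_of_lt (Nat.unpair_left_le _) h0)
      have h2 := hget _ (lt_of_le_of_lt (Nat.unpair_right_le _) h0)
      rw [termValue]
      simp only [step, List.length_map, List.length_range, hget _ h0, h1, h2]

theorem primrec_evalQF : Primrec₂ evalQF := by
  let step (l : List (ℕ × ℕ)) (t : List Bool) (c : ℕ) : Bool :=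
    bif c % 4 == 0 then
      decide ((termValue l (c / 4).unpair.1).1 + (termValue l (c / 4).unpair.2).2 =
        (termValue l (c / 4).unpair.2).1 + (termValue l (c / 4).unpair.1).2)
    else bif c % 4 == 1 then !(t.getD (c / 4) true)
    else bif c % 4 == 2 then t.getD (c / 4).unpair.1 true && t.getD (c / 4).unpair.2 true
    else t.getD (c / 4).unpair.1 true || t.getD (c / 4).unpair.2 true
  have hstep : Primrec fun a : (List (ℕ × ℕ) × List Bool) × ℕ => step a.1.1 a.1.2 a.2 := by
    have hm : ∀ k : ℕ, Primrec fun a : (List (ℕ × ℕ) × List Bool) × ℕ => a.2 % 4 == k :=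
      fun k => Primrec.beq.comp (Primrec.nat_mod.comp .snd (.const 4)) (.const k)
    have hd : Primrec fun a : (List (ℕ × ℕ) × List Bool) × ℕ => a.2 / 4 :=
      Primrec.nat_div.comp .snd (.const 4)
    have hu := Primrec.unpair.comp hd
    have hu1 := Primrec.fst.comp hu
    have hu2 := Primrec.snd.comp hu
    have hl : Primrec fun a : (List (ℕ × ℕ) × List Bool) × ℕ => a.1.1 := Primrec.fst.comp .fst
    have ht : Primrec fun a : (List (ℕ × ℕ) × List Bool) × ℕ => a.1.2 := Primrec.snd.comp .fst
    have hg := Primrec.list_getD true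
    have e1 := primrec_termValue.comp hl hu1
    have e2 := primrec_termValue.comp hl hu2
    refine Primrec.cond (hm 0) ?_ (Primrec.cond (hm 1)
      (Primrec.not.comp (hg.comp ht hd)) (Primrec.cond (hm 2)
      (Primrec.and.comp (hg.comp ht hu1) (hg.comp ht hu2))
      (Primrec.or.comp (hg.comp ht hu1) (hg.comp ht hu2))))
    exact (Primrec.eq.comp
      (Primrec.nat_add.comp (Primrec.fst.comp e1) (Primrec.snd.comp e2))
      (Primrec.nat_add.comp (Primrec.fst.comp e2) (Primrec.snd.comp e1))).decide
  refine Primrec.nat_strong_rec evalQF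
    (g := fun l t => some (Nat.casesOn t.length true fun c => step l t c)) ?_ ?_
  · refine Primrec.option_some.comp (Primrec.nat_casesOn (Primrec.list_length.comp .snd)
      (.const true) ?_)
    exact hstep
  · intro l n
    have hget : ∀ m < n, ((List.range n).map (evalQF l)).getD m true = evalQF l m := by
      intro m hm
      simp [List.getD, hm]
    cases n with
    | zero => simp [evalQF]
    | succ c =>
      have h0 : c / 4 < c + 1 := Nat.lt_succ_of_le (Nat.div_le_self c 4)
      have h1 := hget _ (lt_of_le_of_lt (Nat.unpair_left_le _) h0)
      have h2 := hget _ (lt_of_le_of_lt (Nat.unpair_right_le _) h0)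
      rw [evalQF]
      simp only [step, List.length_map, List.length_range, hget _ h0, h1, h2]

theorem REPred.exists_primcodable {α β : Type*} [Primcodable α] [Primcodable β] {p : α → β → Bool}
    (hp : Computable₂ p) : REPred fun a => ∃ b, p a b = true := by
  have h : Computable₂ fun (a : α) (t : ℕ) =>
      (Option.casesOn (Encodable.decode (α := β) t) false fun b => p a b : Bool) := by
    refine Computable.option_casesOn (Computable.decode.comp .snd) (.const false) ?_
    exact hp.comp (Computable.fst.comp .fst) .snd
  refine (REPred.exists_nat h).of_eq fun a => ?_
  constructor
  · rintro ⟨t, ht⟩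
    cases hb : (Encodable.decode (α := β) t) with
    | none => rw [hb] at ht; simp at ht
    | some b => rw [hb] at ht; exact ⟨b, ht⟩
  · rintro ⟨b, hb⟩
    exact ⟨Encodable.encode b, by simpa using hb⟩

/-! ### Computable copies from computable quotients -/

/-- A group with a computable system of representatives, on which equality is decidable, is
isomorphic to a computable structure. -/
theorem exists_computableStructure {M R : Type*} [Group M] [Primcodable R] (ρ : R → M)
    (hρ : Function.Surjective ρ) (one : R) (inv : R → R) (mul : R → R → R) (eq : R → R → Bool)
    (hinv : Computable inv) (hmul : Computable₂ mul) (heq : Computable₂ eq)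
    (one_spec : ρ one = 1) (inv_spec : ∀ r, ρ (inv r) = (ρ r)⁻¹)
    (mul_spec : ∀ r s, ρ (mul r s) = ρ r * ρ s) (eq_spec : ∀ r s, eq r s = true ↔ ρ r = ρ s) :
    ∃ B : ComputableStructure, Nonempty (groupLang.Equiv B.Universe M) := by
  let dec (n : ℕ) : R := (Encodable.decode (α := R) n).getD one
  have hdec : Computable dec :=
    (Primrec.option_getD.comp Primrec.decode (.const one)).to_comp
  have dec_encode : ∀ r, dec (Encodable.encode r) = r := fun r => by simp [dec]
  have hex : ∀ r, ∃ t, eq r (dec t) = true := fun r =>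
    ⟨Encodable.encode r, by rw [dec_encode, eq_spec]⟩
  -- The least code of a representative of the same element is a canonical name; the universe of the
  -- copy is the set of canonical names.
  let norm (r : R) : ℕ := Nat.find (hex r)
  have hnorm : Computable norm := by
    refine computable_of_isLeast (p := fun r t => eq r (dec t))
      (heq.comp .fst (hdec.comp .snd)) (fun r => Nat.find_spec (hex r)) fun r t ht => ?_
    exact Nat.find_min' (hex r) ht
  have dec_norm : ∀ r, ρ (dec (norm r)) = ρ r := fun r =>
    ((eq_spec _ _).1 (Nat.find_spec (hex r))).symm
  have norm_congr : ∀ r s, ρ r = ρ s → norm r = norm s := by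
    intro r s h
    have : ∀ t, eq r (dec t) = true ↔ eq s (dec t) = true := fun t => by
      rw [eq_spec, eq_spec, h]
    exact Nat.find_congr' fun {t} => this t
  have norm_mem : ∀ r, norm (dec (norm r)) = norm r := fun r => norm_congr _ _ (dec_norm r)
  let B : ComputableStructure :=
    { carrier := {t | norm (dec t) = t}
      one := norm one
      inv := fun t => norm (inv (dec t))
      mul := fun s t => norm (mul (dec s) (dec t))
      one_mem := norm_mem _
      inv_mem := fun _ _ => norm_mem _
      mul_mem := fun _ _ _ _ => norm_mem _
      computable_carrier :=
        ⟨fun t => inferInstanceAs (Decidable (norm (dec t) = t)),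
          (Primrec.eq (α := ℕ)).decide.to_comp.comp (hnorm.comp hdec) .id⟩
      computable_inv := hnorm.comp (hinv.comp hdec)
      computable_mul := hnorm.comp (hmul.comp (hdec.comp .fst) (hdec.comp .snd)) }
  have hcarrier : ∀ t, t ∈ B.carrier ↔ norm (dec t) = t := fun _ => Iff.rfl
  have hone : B.one = norm one := rfl
  have hinv' : ∀ t, B.inv t = norm (inv (dec t)) := fun _ => rfl
  have hmul' : ∀ s t, B.mul s t = norm (mul (dec s) (dec t)) := fun _ _ => rfl
  clear_value B
  have hbij : Function.Bijective fun x : B.Universe => ρ (dec x.1) := by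
    constructor
    · intro x y h
      apply Subtype.ext
      have := norm_congr _ _ h
      rwa [(hcarrier _).1 x.2, (hcarrier _).1 y.2] at this
    · intro m
      obtain ⟨r, rfl⟩ := hρ m
      exact ⟨⟨norm r, (hcarrier _).2 (norm_mem r)⟩, dec_norm r⟩
  refine ⟨B, ⟨⟨Equiv.ofBijective _ hbij, ?_, fun r => Empty.elim r⟩⟩⟩
  intro n F x
  cases F
  · change ρ (dec B.one) = 1
    rw [hone, dec_norm, one_spec]
  · change ρ (dec (B.inv _)) = (ρ (dec _))⁻¹
    rw [hinv', dec_norm, inv_spec]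
  · change ρ (dec (B.mul _ _)) = ρ (dec _) * ρ (dec _)
    rw [hmul', dec_norm, mul_spec]

/-! ### Groups of fractions -/

/-- The product of the values of `g` at the entries of `w`. -/
def denom (g : ℕ → ℕ) (w : List ℕ) : ℕ := (w.map g).prod

theorem denom_append (g : ℕ → ℕ) (w w' : List ℕ) :
    denom g (w ++ w') = denom g w * denom g w' := by
  simp [denom]

theorem denom_pos {g : ℕ → ℕ} (hg : ∀ n, 0 < g n) (w : List ℕ) : 0 < denom g w := by
  refine Nat.pos_of_ne_zero fun h => ?_
  rw [denom, List.prod_eq_zero_iff, List.mem_map] at h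
  obtain ⟨n, -, hn⟩ := h
  exact (hg n).ne' hn

/-- The rational numbers whose denominators divide products of values of `g`. -/
def fractions (g : ℕ → ℕ) : AddSubgroup ℚ where
  carrier := {x | ∃ (w : List ℕ) (a : ℤ), x * denom g w = a}
  zero_mem' := ⟨[], 0, by simp⟩
  add_mem' := by
    rintro x y ⟨w, a, h⟩ ⟨w', b, h'⟩
    refine ⟨w ++ w', a * denom g w' + b * denom g w, ?_⟩
    rw [denom_append]
    push_cast
    rw [← h, ← h']
    ring
  neg_mem' := by
    rintro x ⟨w, a, h⟩
    exact ⟨w, -a, by push_cast; rw [← h]; ring⟩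

theorem mem_fractions {g : ℕ → ℕ} {x : ℚ} :
    x ∈ fractions g ↔ ∃ (w : List ℕ) (a : ℤ), x * denom g w = a := Iff.rfl

theorem div_denom_mem {g : ℕ → ℕ} (hg : ∀ n, 0 < g n) (a : ℤ) (w : List ℕ) :
    (a : ℚ) / denom g w ∈ fractions g :=
  ⟨w, a, div_mul_cancel₀ _ (by exact_mod_cast (denom_pos hg w).ne')⟩

/-- Finitely many fractions have a common denominator. -/
theorem exists_common_denom {g : ℕ → ℕ} {m : ℕ} (y : Fin m → ℚ)
    (hy : ∀ i, y i ∈ fractions g) :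
    ∃ (w : List ℕ) (a : Fin m → ℤ), ∀ i, y i * denom g w = a i := by
  choose w a h using fun i => mem_fractions.1 (hy i)
  -- Concatenating all the lists multiplies all the denominators.
  have hd : ∀ i, denom g (w i) ∣ denom g (List.ofFn w).flatten := fun i =>
    ((List.sublist_flatten_of_mem ((List.mem_ofFn' _ _).2 ⟨i, rfl⟩)).map g).prod_dvd_prod
  choose k hk using hd
  refine ⟨(List.ofFn w).flatten, fun i => a i * k i, fun i => ?_⟩
  rw [hk i]
  push_cast
  rw [← h i]
  ring

theorem primrec_denom {α : Type*} [Primcodable α] {g : α → ℕ → ℕ} (hg : Primrec₂ g)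
    {w : α → List ℕ} (hw : Primrec w) : Primrec fun a => denom (g a) (w a) := by
  refine (Primrec.list_foldr (h := fun a (p : ℕ × ℕ) => g a p.1 * p.2) hw (.const 1) ?_).of_eq
    fun a => ?_
  · exact Primrec.nat_mul.comp (hg.comp .fst (Primrec.fst.comp .snd)) (Primrec.snd.comp .snd)
  · rw [denom, List.prod_eq_foldr, List.foldr_map]

/-- Elements are named by a numerator and a list of indices into `g`. Every such name is legitimate,
so membership in the group, which may be undecidable, is never tested; equality is decided by
cross-multiplication. -/
theorem exists_computable_copy_fractions {g : ℕ → ℕ} (hg : Primrec g) (hpos : ∀ n, 0 < g n) :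
    ∃ B : ComputableStructure,
      Nonempty (groupLang.Equiv B.Universe (Multiplicative (fractions g))) := by
  have hne : ∀ w, (denom g w : ℚ) ≠ 0 := fun w => by exact_mod_cast (denom_pos hpos w).ne'
  have hd {α : Type} [Primcodable α] {w : α → List ℕ} (hw : Primrec w) :
      Primrec fun a => denom g (w a) := primrec_denom (g := fun _ => g) (hg.comp .snd) hw
  refine exists_computableStructure (R := (ℕ × ℕ) × List ℕ)
    (fun r => Multiplicative.ofAdd ⟨(pairToInt r.1 : ℚ) / denom g r.2, div_denom_mem hpos _ _⟩)
    ?_ ((0, 0), []) (fun r => (r.1.swap, r.2))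
    (fun r s => ((r.1.1 * denom g s.2 + s.1.1 * denom g r.2,
      r.1.2 * denom g s.2 + s.1.2 * denom g r.2), r.2 ++ s.2))
    (fun r s => decide (r.1.1 * denom g s.2 + s.1.2 * denom g r.2 =
      s.1.1 * denom g r.2 + r.1.2 * denom g s.2)) ?_ ?_ ?_ ?_ ?_ ?_ ?_
  · intro x
    obtain ⟨w, a, h⟩ := x.toAdd.2
    refine ⟨((a.toNat, (-a).toNat), w), ?_⟩
    apply Multiplicative.toAdd.injective
    apply Subtype.ext
    change (pairToInt (a.toNat, (-a).toNat) : ℚ) / denom g w = (x.toAdd : ℚ)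
    rw [div_eq_iff (hne w), h]
    simp only [pairToInt, Int.toNat_sub_toNat_neg]
  · exact ((primrec_pairSwap.comp .fst).pair .snd).to_comp
  · have h11 : Primrec fun p : ((ℕ × ℕ) × List ℕ) × ((ℕ × ℕ) × List ℕ) => p.1.1 :=
      Primrec.fst.comp .fst
    have h21 : Primrec fun p : ((ℕ × ℕ) × List ℕ) × ((ℕ × ℕ) × List ℕ) => p.2.1 :=
      Primrec.fst.comp .snd
    have h12 : Primrec fun p : ((ℕ × ℕ) × List ℕ) × ((ℕ × ℕ) × List ℕ) => p.1.2 :=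
      Primrec.snd.comp .fst
    have h22 : Primrec fun p : ((ℕ × ℕ) × List ℕ) × ((ℕ × ℕ) × List ℕ) => p.2.2 :=
      Primrec.snd.comp .snd
    exact (((Primrec.nat_add.comp (Primrec.nat_mul.comp (Primrec.fst.comp h11) (hd h22))
      (Primrec.nat_mul.comp (Primrec.fst.comp h21) (hd h12))).pair
      (Primrec.nat_add.comp (Primrec.nat_mul.comp (Primrec.snd.comp h11) (hd h22))
      (Primrec.nat_mul.comp (Primrec.snd.comp h21) (hd h12)))).pair
      (Primrec.list_append.comp h12 h22)).to_comp
  · have h11 : Primrec fun p : ((ℕ × ℕ) × List ℕ) × ((ℕ × ℕ) × List ℕ) => p.1.1 :=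
      Primrec.fst.comp .fst
    have h21 : Primrec fun p : ((ℕ × ℕ) × List ℕ) × ((ℕ × ℕ) × List ℕ) => p.2.1 :=
      Primrec.fst.comp .snd
    have h12 : Primrec fun p : ((ℕ × ℕ) × List ℕ) × ((ℕ × ℕ) × List ℕ) => p.1.2 :=
      Primrec.snd.comp .fst
    have h22 : Primrec fun p : ((ℕ × ℕ) × List ℕ) × ((ℕ × ℕ) × List ℕ) => p.2.2 :=
      Primrec.snd.comp .snd
    exact (Primrec.eq.comp
      (Primrec.nat_add.comp (Primrec.nat_mul.comp (Primrec.fst.comp h11) (hd h22))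
      (Primrec.nat_mul.comp (Primrec.snd.comp h21) (hd h12)))
      (Primrec.nat_add.comp (Primrec.nat_mul.comp (Primrec.fst.comp h21) (hd h12))
      (Primrec.nat_mul.comp (Primrec.snd.comp h11) (hd h22)))).decide.to_comp
  · apply Multiplicative.toAdd.injective
    apply Subtype.ext
    change (pairToInt (0, 0) : ℚ) / denom g [] = 0
    simp [pairToInt]
  · intro r
    apply Multiplicative.toAdd.injective
    apply Subtype.ext
    change (pairToInt r.1.swap : ℚ) / denom g r.2 = -((pairToInt r.1 : ℚ) / denom g r.2)
    simp only [pairToInt, Prod.fst_swap, Prod.snd_swap]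
    push_cast
    ring
  · intro r s
    apply Multiplicative.toAdd.injective
    apply Subtype.ext
    change (pairToInt (r.1.1 * denom g s.2 + s.1.1 * denom g r.2,
      r.1.2 * denom g s.2 + s.1.2 * denom g r.2) : ℚ) / denom g (r.2 ++ s.2) =
      (pairToInt r.1 : ℚ) / denom g r.2 + (pairToInt s.1 : ℚ) / denom g s.2
    have h1 := hne r.2
    have h2 := hne s.2
    rw [denom_append]
    simp only [pairToInt]
    push_cast
    field_simp
    ring
  · intro r s
    rw [decide_eq_true_eq, Multiplicative.ofAdd.injective.eq_iff, Subtype.mk.injEq,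
      div_eq_div_iff (hne _) (hne _)]
    simp only [pairToInt]
    rw [← @Nat.cast_inj ℚ]
    push_cast
    constructor <;> intro h <;> linarith

/-- The sequence `q, g 0, g 1, …`. -/
def consSeq (q : ℕ) (g : ℕ → ℕ) (n : ℕ) : ℕ := Nat.casesOn n q fun m => g m

theorem primrec_consSeq {g : ℕ → ℕ} (hg : Primrec g) : Primrec₂ fun q n => consSeq q g n :=
  Primrec.nat_casesOn .snd .fst (hg.comp .snd)

theorem consSeq_pos {q : ℕ} {g : ℕ → ℕ} (hq : 0 < q) (hg : ∀ n, 0 < g n) :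
    ∀ n, 0 < consSeq q g n
  | 0 => hq
  | n + 1 => hg n

theorem denom_consSeq_map_succ (q : ℕ) (g : ℕ → ℕ) (w : List ℕ) :
    denom (consSeq q g) (w.map Nat.succ) = denom g w := by
  rw [denom, denom, List.map_map]
  rfl

theorem denom_consSeq_replicate (q : ℕ) (g : ℕ → ℕ) (k : ℕ) :
    denom (consSeq q g) (List.replicate k 0) = q ^ k := by
  simp [denom, consSeq]

/-- A product over the sequence `q, g 0, g 1, …` is a power of `q` times a product over `g`. -/
theorem denom_consSeq_eq (q : ℕ) (g : ℕ → ℕ) (w : List ℕ) :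
    ∃ (k : ℕ) (w' : List ℕ), denom (consSeq q g) w = q ^ k * denom g w' := by
  induction w with
  | nil => exact ⟨0, [], by simp [denom]⟩
  | cons n w ih =>
    obtain ⟨k, w', h⟩ := ih
    have hc : denom (consSeq q g) (n :: w) = consSeq q g n * denom (consSeq q g) w := by
      simp [denom]
    cases n with
    | zero =>
      refine ⟨k + 1, w', ?_⟩
      rw [hc, h]
      change q * _ = _
      ring
    | succ n =>
      refine ⟨k, n :: w', ?_⟩
      rw [hc, h]
      simp only [consSeq, denom, List.map_cons, List.prod_cons]
      ring

/-! ### Failure of `Π_1` formulas is uniformly c.e. -/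

/-- The pair representing `d` times the integer represented by `p`. -/
def scalePair (d : ℕ) (p : ℕ × ℕ) : ℕ × ℕ := (d * p.1, d * p.2)

theorem pairToInt_scalePair (d : ℕ) (p : ℕ × ℕ) :
    pairToInt (scalePair d p) = d * pairToInt p := by
  simp only [pairToInt, scalePair]
  push_cast
  ring

theorem primrec_map_scalePair {α : Type*} [Primcodable α] {d : α → ℕ} (hd : Primrec d)
    {l : α → List (ℕ × ℕ)} (hl : Primrec l) :
    Primrec fun a => (l a).map (scalePair (d a)) := by
  refine Primrec.list_map hl ?_
  exact (Primrec.nat_mul.comp (hd.comp .fst) (Primrec.fst.comp .snd)).pair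
    (Primrec.nat_mul.comp (hd.comp .fst) (Primrec.snd.comp .snd))

theorem getD_map_scalePair (d : ℕ) (l : List (ℕ × ℕ)) (i : ℕ) :
    (l.map (scalePair d)).getD i (0, 0) = scalePair d (l.getD i (0, 0)) := by
  have : ((0, 0) : ℕ × ℕ) = scalePair d (0, 0) := rfl
  conv_lhs => rw [this]
  rw [List.getD_map]

/-- The condition that the instance of the `Π_1` formula with index `j` that is coded by `T` fails
in `fractions (consSeq q g)` at the tuple of the quotients of `Z` by `d`. Here `T` consists of an
element of `W j`, a stage at which it has been enumerated, a denominator and a list of numerators. -/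
def refutes (g : ℕ → ℕ) (j : ℕ) (Z : List (ℕ × ℕ)) (d q : ℕ)
    (T : (ℕ × ℕ) × (List ℕ × List (ℕ × ℕ))) : Bool :=
  (Nat.Partrec.Code.evaln T.1.2 (Denumerable.ofNat Nat.Partrec.Code j) T.1.1).isSome &&
    (decide (level T.1.1 = 0) && (decide (T.2.2.length = tupleLength T.1.1) &&
      !(evalQF (Z.map (scalePair (denom (consSeq q g) T.2.1)) ++ T.2.2.map (scalePair d))
        (subIndex T.1.1))))

/-- The point is uniformity: `j`, `Z` and `d` are fixed, while the added number `q` is an argument.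
-/
theorem computable_refutes {g : ℕ → ℕ} (hg : Primrec g) (j : ℕ) (Z : List (ℕ × ℕ)) (d : ℕ) :
    Computable₂ (refutes g j Z d) := by
  have hi : Primrec fun a : ℕ × ((ℕ × ℕ) × (List ℕ × List (ℕ × ℕ))) => a.2.1.1 :=
    Primrec.fst.comp (Primrec.fst.comp .snd)
  have hs : Primrec fun a : ℕ × ((ℕ × ℕ) × (List ℕ × List (ℕ × ℕ))) => a.2.1.2 :=
    Primrec.snd.comp (Primrec.fst.comp .snd)
  have hw : Primrec fun a : ℕ × ((ℕ × ℕ) × (List ℕ × List (ℕ × ℕ))) => a.2.2.1 :=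
    Primrec.fst.comp (Primrec.snd.comp .snd)
  have hy : Primrec fun a : ℕ × ((ℕ × ℕ) × (List ℕ × List (ℕ × ℕ))) => a.2.2.2 :=
    Primrec.snd.comp (Primrec.snd.comp .snd)
  have hu := Primrec.unpair.comp hi
  have hu2 := Primrec.unpair.comp (Primrec.snd.comp hu)
  have hd : Primrec fun a : ℕ × ((ℕ × ℕ) × (List ℕ × List (ℕ × ℕ))) =>
      denom (consSeq a.1 g) a.2.2.1 :=
    primrec_denom (g := fun a => consSeq a.1 g)
      ((primrec_consSeq hg).comp (Primrec.fst.comp .fst) .snd) hw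
  have h1 := Primrec.option_isSome.comp (Nat.Partrec.Code.primrec_evaln.comp
    ((hs.pair (.const (Denumerable.ofNat Nat.Partrec.Code j))).pair hi))
  have h2 := (Primrec.eq.comp (Primrec.fst.comp hu) (.const 0)).decide
  have h3 := (Primrec.eq.comp (Primrec.list_length.comp hy) (Primrec.fst.comp hu2)).decide
  have h4 := Primrec.not.comp (primrec_evalQF.comp (Primrec.list_append.comp
    (primrec_map_scalePair hd (.const Z)) (primrec_map_scalePair (.const d) hy))
    (Primrec.snd.comp hu2))
  exact (Primrec.and.comp h1 (Primrec.and.comp h2 (Primrec.and.comp h3 h4))).to_comp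

theorem mem_W_iff (e i : ℕ) :
    i ∈ W e ↔ ∃ s, (Nat.Partrec.Code.evaln s (Denumerable.ofNat Nat.Partrec.Code e) i).isSome := by
  change ((Denumerable.ofNat Nat.Partrec.Code e).eval i).Dom ↔ _
  rw [Part.dom_iff_mem]
  simp only [Nat.Partrec.Code.evaln_complete, Option.isSome_iff_exists, Option.mem_def]
  exact exists_comm

/-- Multiplication by the inverse of a denominator, on the integers. -/
def intToFractions {g : ℕ → ℕ} (hg : ∀ n, 0 < g n) (w : List ℕ) : ℤ →+ fractions g where
  toFun a := ⟨(a : ℚ) / denom g w, div_denom_mem hg a w⟩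
  map_zero' := by ext; simp
  map_add' a b := by ext; simp [add_div]

theorem intToFractions_injective {g : ℕ → ℕ} (hg : ∀ n, 0 < g n) (w : List ℕ) :
    Function.Injective (intToFractions hg w) := by
  intro a b h
  have h' : (a : ℚ) / denom g w = b / denom g w := congrArg Subtype.val h
  have hne : (denom g w : ℚ) ≠ 0 := by exact_mod_cast (denom_pos hg w).ne'
  rw [div_left_inj' hne] at h'
  exact_mod_cast h'

/-- Quantifier-free formulas at fractions are evaluated at numerators over a common denominator. -/
theorem realize_decodeQF_append {g : ℕ → ℕ} (hg : ∀ n, 0 < g n) {n m : ℕ}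
    (c : Fin n → Multiplicative (fractions g)) (y : Fin m → Multiplicative (fractions g))
    (w₀ w : List ℕ) {Z Y : List (ℕ × ℕ)} (hZ : Z.length = n) (hY : Y.length = m)
    (hc : ∀ i, ((c i).toAdd : ℚ) * denom g w₀ = pairToInt (Z.getD i (0, 0)))
    (hy : ∀ i, ((y i).toAdd : ℚ) * denom g w = pairToInt (Y.getD i (0, 0))) (e : ℕ) :
    (decodeQF (n + m) e).Realize (Fin.append c y) ↔
      evalQF (Z.map (scalePair (denom g w)) ++ Y.map (scalePair (denom g w₀))) e = true := by
  have hl : (Z.map (scalePair (denom g w)) ++ Y.map (scalePair (denom g w₀))).length = n + m := by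
    simp [hZ, hY]
  -- Dividing by the product of both denominators embeds the integers in the group, and the tuple is
  -- the image of its cross-scaled numerators.
  rw [← realize_decodeQF hl, ← realize_decodeQF_embedding
    (embeddingOfAddHom (intToFractions hg (w₀ ++ w)) (intToFractions_injective hg _))]
  have h0 : (denom g w₀ : ℚ) ≠ 0 := by exact_mod_cast (denom_pos hg w₀).ne'
  have h1 : (denom g w : ℚ) ≠ 0 := by exact_mod_cast (denom_pos hg w).ne'
  refine iff_of_eq (congrArg _ (funext fun i => ?_))
  apply Multiplicative.toAdd.injective
  apply Subtype.ext
  change _ = (pairToInt (List.getD _ (i : ℕ) (0, 0)) : ℚ) / denom g (w₀ ++ w)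
  rw [denom_append]
  push_cast
  rw [eq_div_iff (mul_ne_zero h0 h1)]
  refine Fin.addCases (fun i => ?_) (fun i => ?_) i
  · rw [Fin.append_left, Fin.val_castAdd, List.getD_append _ _ _ _ (by simp [hZ]),
      getD_map_scalePair, pairToInt_scalePair]
    push_cast
    rw [← hc]
    ring
  · rw [Fin.append_right, Fin.val_natAdd, List.getD_append_right _ _ _ _ (by simp [hZ]),
      List.length_map, hZ, Nat.add_sub_cancel_left, getD_map_scalePair, pairToInt_scalePair]
    push_cast
    rw [← hy]
    ring

/-- A `Π_1` formula fails exactly when one of its quantifier-free instances is false at some tuple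
of fractions, and such a failure is finite, checkable data. The parameters `c` enter only through
numerators over a denominator free of `q`, so the search is uniform in `q`. -/
theorem exists_refutes_iff {g : ℕ → ℕ} (hg : ∀ n, 0 < g n) {n : ℕ} (j : ℕ) (w₀ : List ℕ)
    {Z : List (ℕ × ℕ)} (hZ : Z.length = n) {q : ℕ} (hq : 0 < q)
    (c : Fin n → Multiplicative (fractions (consSeq q g)))
    (hc : ∀ i, ((c i).toAdd : ℚ) * denom g w₀ = pairToInt (Z.getD i (0, 0))) :
    (∃ T, refutes g j Z (denom g w₀) q T = true) ↔ ¬ (piFormula 1 n j).Realize c := by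
  have hpos := consSeq_pos hq hg
  have hd := denom_consSeq_map_succ q g w₀
  -- Shifting indices by one makes the denominator over `g` one over `consSeq q g`.
  rw [← hd] at hc ⊢
  rw [realize_piFormula_succ]
  push Not
  constructor
  · rintro ⟨⟨⟨i, s⟩, w, Y⟩, h⟩
    simp only [refutes, Bool.and_eq_true, decide_eq_true_eq, Bool.not_eq_true',
      ← Bool.not_eq_true] at h
    obtain ⟨h1, h2, h3, h4⟩ := h
    refine ⟨i, (mem_W_iff _ _).2 ⟨s, h1⟩, by omega, fun k => Multiplicative.ofAdd
      ⟨(pairToInt (Y.getD k (0, 0)) : ℚ) / denom (consSeq q g) w, div_denom_mem hpos _ _⟩, ?_⟩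
    rw [h2, sigmaFormula_zero]
    rwa [realize_decodeQF_append hpos _ _ (w₀.map Nat.succ) w hZ h3 hc]
    intro k
    have hne : (denom (consSeq q g) w : ℚ) ≠ 0 := by exact_mod_cast (denom_pos hpos w).ne'
    exact div_mul_cancel₀ _ hne
  · rintro ⟨i, hi, hl, y, hy⟩
    have hl0 : level i = 0 := by omega
    obtain ⟨s, hs⟩ := (mem_W_iff _ _).1 hi
    obtain ⟨w, a, ha⟩ := exists_common_denom (fun k => ((y k).toAdd : ℚ))
      fun k => (y k).toAdd.2
    refine ⟨⟨⟨i, s⟩, w, List.ofFn fun k => ((a k).toNat, (-a k).toNat)⟩, ?_⟩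
    rw [hl0, sigmaFormula_zero, realize_decodeQF_append hpos _ _ (w₀.map Nat.succ) w hZ
      (Y := List.ofFn fun k => ((a k).toNat, (-a k).toNat)) (List.length_ofFn) hc] at hy
    · simp only [refutes, Bool.and_eq_true, decide_eq_true_eq, Bool.not_eq_true',
        ← Bool.not_eq_true]
      exact ⟨hs, hl0, List.length_ofFn, hy⟩
    · intro k
      rw [ha, List.getD_eq_getElem _ _ (by simp)]
      simp [pairToInt]

/-! ### The group `G` as a group of fractions -/

/-- The primes indexed by a c.e. set are, together with `1`, the values of a primitive recursive
function. -/
theorem exists_enumeration {X : Set ℕ} (hce : REPred fun i => i ∈ X) :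
    ∃ g : ℕ → ℕ, Primrec g ∧ (∀ n, g n = 1 ∨ ∃ i ∈ X, g n = Nat.nth Nat.Prime i) ∧
      ∀ i ∈ X, ∃ n, g n = Nat.nth Nat.Prime i := by
  -- Halts on `p` exactly when `p` is the `i`-th prime for some `i ∈ X`: search for the index, then
  -- semidecide membership.
  have hpart : Partrec fun p : ℕ =>
      (Nat.rfind fun i => Part.some (decide (Nat.nth Nat.Prime i = p))).bind
        fun i => (Part.assert (i ∈ X) fun _ => Part.some ()).map fun _ => (0 : ℕ) := by
    refine Partrec.bind (Partrec.rfind ?_) ?_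
    · exact ((Primrec.eq (α := ℕ)).decide.to_comp.comp (computable_nthPrime.comp .snd) .fst)
    · exact Partrec.map (Partrec.comp hce .snd) (Computable.const 0).to₂
  obtain ⟨c, hc⟩ := Nat.Partrec.Code.exists_code.1 (Partrec.nat_iff.1 hpart)
  have hdom : ∀ p, (c.eval p).Dom ↔ ∃ i ∈ X, p = Nat.nth Nat.Prime i := by
    intro p
    rw [hc, Part.dom_iff_mem]
    constructor
    · rintro ⟨x, hx⟩
      obtain ⟨i, hi, hx⟩ := Part.mem_bind_iff.1 hx
      obtain ⟨_, hx, -⟩ := (Part.mem_map_iff _).1 hx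
      obtain ⟨hX, -⟩ := Part.mem_assert_iff.1 hx
      have := Nat.rfind_spec hi
      rw [Part.mem_some_iff] at this
      exact ⟨i, hX, (of_decide_eq_true this.symm).symm⟩
    · rintro ⟨i, hX, rfl⟩
      refine ⟨0, Part.mem_bind_iff.2 ⟨i, Nat.mem_rfind.2 ⟨by simp, fun {k} hk => ?_⟩,
        (Part.mem_map_iff _).2 ⟨(), Part.mem_assert_iff.2 ⟨hX, by simp⟩, rfl⟩⟩⟩
      rw [Part.mem_some_iff, eq_comm, decide_eq_false_iff_not]
      exact ((Nat.nth_strictMono Nat.infinite_setOfPred_prime) hk).ne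
  -- `n` codes a candidate and a stage. The output is the candidate if halting is seen by that
  -- stage, else `1`, which is harmless in a product of denominators.
  refine ⟨fun n => bif (Nat.Partrec.Code.evaln n.unpair.2 c n.unpair.1).isSome then n.unpair.1
    else 1, ?_, fun n => ?_, fun i hi => ?_⟩
  · have hu := Primrec.unpair
    exact Primrec.cond (Primrec.option_isSome.comp (Nat.Partrec.Code.primrec_evaln.comp
      (((Primrec.snd.comp hu).pair (.const c)).pair (Primrec.fst.comp hu))))
      (Primrec.fst.comp hu) (.const 1)
  · dsimp only
    cases h : (Nat.Partrec.Code.evaln n.unpair.2 c n.unpair.1).isSome with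
    | false => exact .inl rfl
    | true =>
      obtain ⟨x, hx⟩ := Option.isSome_iff_exists.1 h
      exact .inr ((hdom _).1 (Part.dom_iff_mem.2 ⟨x, Nat.Partrec.Code.evaln_sound hx⟩))
  · obtain ⟨x, hx⟩ := Part.dom_iff_mem.1 ((hdom _).2 ⟨i, hi, rfl⟩)
    obtain ⟨s, hs⟩ := Nat.Partrec.Code.evaln_complete.1 hx
    refine ⟨Nat.pair (Nat.nth Nat.Prime i) s, ?_⟩
    simp only [Nat.unpair_pair]
    rw [Option.isSome_iff_exists.2 ⟨x, hs⟩]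
    rfl

theorem dividesOne_iff {G : AddSubgroup ℚ} {m : ℕ} (hm : 0 < m) :
    DividesOne G m ↔ (m : ℚ)⁻¹ ∈ G := by
  have hne : (m : ℚ) ≠ 0 := by exact_mod_cast hm.ne'
  constructor
  · rintro ⟨x, hx, h⟩
    rw [nsmul_eq_mul] at h
    rwa [← eq_inv_of_mul_eq_one_right h]
  · intro h
    exact ⟨_, h, by rw [nsmul_eq_mul, mul_inv_cancel₀ hne]⟩

/-- Bézout: if `a * u + b * v = 1`, then `1 / (a * b) = v / a + u / b`. -/
theorem inv_mem_of_coprime {G : AddSubgroup ℚ} {a b : ℕ} (ha : 0 < a) (hb : 0 < b)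
    (hab : a.Coprime b) (h : (a : ℚ)⁻¹ ∈ G) (h' : (b : ℚ)⁻¹ ∈ G) : ((a * b : ℕ) : ℚ)⁻¹ ∈ G := by
  have hane : (a : ℚ) ≠ 0 := by exact_mod_cast ha.ne'
  have hbne : (b : ℚ) ≠ 0 := by exact_mod_cast hb.ne'
  have hbez : (a : ℚ) * a.gcdA b + b * a.gcdB b = 1 := by
    have := Nat.gcd_eq_gcd_ab a b
    rw [hab.gcd_eq_one] at this
    exact_mod_cast this.symm
  have : ((a * b : ℕ) : ℚ)⁻¹ = a.gcdB b • (a : ℚ)⁻¹ + a.gcdA b • (b : ℚ)⁻¹ := by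
    rw [zsmul_eq_mul, zsmul_eq_mul]
    push_cast
    field_simp
    linarith
  rw [this]
  exact G.add_mem (G.zsmul_mem h _) (G.zsmul_mem h' _)

theorem inv_mem_of_dvd {G : AddSubgroup ℚ} {a b : ℕ} (hb : 0 < b) (hab : a ∣ b)
    (h : (b : ℚ)⁻¹ ∈ G) : (a : ℚ)⁻¹ ∈ G := by
  obtain ⟨k, rfl⟩ := hab
  have ha : (a : ℚ) ≠ 0 := by
    rintro h0
    simp [Nat.cast_eq_zero.1 h0] at hb
  have hk : (k : ℚ) ≠ 0 := by
    rintro h0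
    simp [Nat.cast_eq_zero.1 h0] at hb
  have : (a : ℚ)⁻¹ = k • ((a * k : ℕ) : ℚ)⁻¹ := by
    rw [nsmul_eq_mul]
    push_cast
    field_simp
  rw [this]
  exact G.nsmul_mem h _

/-- As `p` may already divide `b`, write `b = p ^ k * m` with `p ∤ m` and combine the inverses of
the coprime numbers `p ^ (k + 1)` and `m`. -/
theorem inv_mul_mem_of_mem_PInf {G : AddSubgroup ℚ} {p b : ℕ} (hp : p ∈ PInf G) (hb : 0 < b)
    (h : (b : ℚ)⁻¹ ∈ G) : ((p * b : ℕ) : ℚ)⁻¹ ∈ G := by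
  obtain ⟨k, m, hm, rfl⟩ := Nat.exists_eq_pow_mul_and_not_dvd hb.ne' p hp.1.ne_one
  have hm0 : 0 < m := Nat.pos_of_ne_zero fun h => hm (h ▸ dvd_zero p)
  have h1 := (dividesOne_iff (pow_pos hp.1.pos _)).1 (hp.2 (k + 1))
  have h2 := inv_mem_of_dvd hb (Dvd.intro_left _ rfl) h
  have := inv_mem_of_coprime (pow_pos hp.1.pos (k + 1)) hm0
    (Nat.Coprime.pow_left _ ((Nat.Prime.coprime_iff_not_dvd hp.1).2 hm)) h1 h2
  rwa [← mul_assoc, ← pow_succ']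

/-- Bézout for the coprime numerator and denominator of `x`, using `1 ∈ G`. -/
theorem inv_den_mem {G : AddSubgroup ℚ} (h1 : (1 : ℚ) ∈ G) {x : ℚ} (hx : x ∈ G) :
    (x.den : ℚ)⁻¹ ∈ G := by
  have hbez : (x.num : ℚ) * Int.gcdA x.num x.den + x.den * Int.gcdB x.num x.den = 1 := by
    have := Int.gcd_eq_gcd_ab x.num x.den
    rw [show Int.gcd x.num x.den = 1 from x.reduced] at this
    exact_mod_cast this.symm
  have : (x.den : ℚ)⁻¹ = Int.gcdA x.num x.den • x + Int.gcdB x.num x.den • (1 : ℚ) := by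
    rw [zsmul_eq_mul, zsmul_eq_mul]
    refine (eq_inv_of_mul_eq_one_left ?_).symm
    linear_combination hbez + (Int.gcdA x.num x.den : ℚ) * Rat.mul_den_eq_num x
  rw [this]
  exact G.add_mem (G.zsmul_mem hx _) (G.zsmul_mem h1 _)

/-- A prime dividing the denominator of an element of `G` divides `1` in `G`, hence does so
infinitely often because `P^fin(G)` is empty. Conversely, inverses of products of values of `g` are
built in `G` one factor at a time. -/
theorem eq_fractions {G : AddSubgroup ℚ} (h1 : (1 : ℚ) ∈ G) (hfin : PFin G = ∅) {g : ℕ → ℕ}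
    (hg : ∀ n, g n = 1 ∨ g n ∈ PInf G) (hg' : ∀ p ∈ PInf G, ∃ n, g n = p) :
    G = fractions g := by
  have hpos : ∀ n, 0 < g n := fun n => by
    rcases hg n with h | h
    · omega
    · exact h.1.pos
  have hprod : ∀ b : ℕ, 0 < b → (∀ p, p.Prime → p ∣ b → p ∈ PInf G) → ∃ w, denom g w = b := by
    intro b
    induction b using Nat.recOnMul with
    | zero => exact fun h => absurd h (lt_irrefl 0)
    | one => exact fun _ _ => ⟨[], rfl⟩
    | prime p hp =>
      intro _ h
      obtain ⟨n, hn⟩ := hg' p (h p hp dvd_rfl)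
      exact ⟨[n], by simp [denom, hn]⟩
    | mul a b iha ihb =>
      intro hab h
      obtain ⟨w, hw⟩ := iha (Nat.pos_of_mul_pos_right hab)
        fun p hp hpa => h p hp (hpa.mul_right b)
      obtain ⟨w', hw'⟩ := ihb (Nat.pos_of_mul_pos_left hab)
        fun p hp hpb => h p hp (hpb.mul_left a)
      exact ⟨w ++ w', by rw [denom_append, hw, hw']⟩
  apply le_antisymm
  · intro x hx
    have hden := inv_den_mem h1 hx
    obtain ⟨w, hw⟩ := hprod x.den x.den_pos fun p hp hpx => by
      have hp1 : DividesOne G p := (dividesOne_iff hp.pos).2 (inv_mem_of_dvd x.den_pos hpx hden)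
      refine ⟨hp, fun k => ?_⟩
      by_contra hk
      exact Set.notMem_empty p (hfin ▸ (⟨hp, hp1, k, hk⟩ : p ∈ PFin G))
    exact ⟨w, x.num, by rw [hw, Rat.mul_den_eq_num]⟩
  · rintro x ⟨w, a, h⟩
    have hinv : ((denom g w : ℕ) : ℚ)⁻¹ ∈ G := by
      clear h
      induction w with
      | nil => simpa [denom] using h1
      | cons n w ih =>
        have hc : denom g (n :: w) = g n * denom g w := by simp [denom]
        rw [hc]
        rcases hg n with h | h
        · rwa [h, one_mul]
        · exact inv_mul_mem_of_mem_PInf h (denom_pos hpos w) ih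
    have hne : (denom g w : ℚ) ≠ 0 := by exact_mod_cast (denom_pos hpos w).ne'
    rw [eq_div_of_mul_eq hne h, div_eq_mul_inv, ← zsmul_eq_mul]
    exact G.zsmul_mem hinv a

/-! ### Adding one prime -/

/-- Division by `q ^ k`, from `fractions g` to the group where `q` has been made invertible. -/
def divPow {q : ℕ} (hq : 0 < q) (g : ℕ → ℕ) (k : ℕ) :
    fractions g →+ fractions (consSeq q g) where
  toFun x := ⟨(x : ℚ) / q ^ k, by
    obtain ⟨w, a, h⟩ := x.2
    refine ⟨List.replicate k 0 ++ w.map Nat.succ, a, ?_⟩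
    rw [denom_append, denom_consSeq_replicate, denom_consSeq_map_succ, ← h]
    have hne : (q : ℚ) ≠ 0 := by exact_mod_cast hq.ne'
    push_cast
    field_simp⟩
  map_zero' := by ext; simp
  map_add' a b := by ext; simp [add_div]

theorem divPow_injective {q : ℕ} (hq : 0 < q) (g : ℕ → ℕ) (k : ℕ) :
    Function.Injective (divPow hq g k) := by
  intro a b h
  have h' : (a : ℚ) / q ^ k = b / q ^ k := congrArg Subtype.val h
  have hne : (q : ℚ) ^ k ≠ 0 := pow_ne_zero _ (by exact_mod_cast hq.ne')
  rw [div_left_inj' hne] at h'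
  exact Subtype.ext h'

/-- `divPow` as an embedding of structures. -/
def divPowEmbedding {q : ℕ} (hq : 0 < q) (g : ℕ → ℕ) (k : ℕ) :
    Multiplicative (fractions g) ↪[groupLang] Multiplicative (fractions (consSeq q g)) :=
  embeddingOfAddHom (divPow hq g k) (divPow_injective hq g k)

/-- Adding a prime that is already a value of `g` does not change the group. -/
noncomputable def divPowEquiv {q : ℕ} (hq : 0 < q) {g : ℕ → ℕ} {n : ℕ} (hn : g n = q) :
    Multiplicative (fractions g) ≃[groupLang] Multiplicative (fractions (consSeq q g)) where
  toEquiv := Equiv.ofBijective (divPowEmbedding hq g 0) ⟨(divPowEmbedding hq g 0).injective, by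
    intro x
    obtain ⟨w, a, h⟩ := x.toAdd.2
    obtain ⟨k, w', hk⟩ := denom_consSeq_eq q g w
    -- Each factor `q` contributed by the new index `0` is replaced by the equal value `g n`.
    refine ⟨Multiplicative.ofAdd ⟨x.toAdd, List.replicate k n ++ w', a, ?_⟩, ?_⟩
    · rw [denom_append, ← h, hk]
      simp [denom, hn]
    · apply Multiplicative.toAdd.injective
      apply Subtype.ext
      change (x.toAdd : ℚ) / q ^ 0 = x.toAdd
      rw [pow_zero, div_one]⟩
  map_fun' := (divPowEmbedding hq g 0).map_fun'
  map_rel' := (divPowEmbedding hq g 0).map_rel'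

/-- A common denominator of a finite tuple contains only a finite power `q ^ k`, so the tuple lies
in the copy of `fractions g` divided by `q ^ k`. -/
theorem exists_eq_divPow {q : ℕ} (hq : 0 < q) (g : ℕ → ℕ) (n : ℕ)
    (v : Fin n → Multiplicative (fractions (consSeq q g))) :
    ∃ (k : ℕ) (u : Fin n → Multiplicative (fractions g)), v = divPowEmbedding hq g k ∘ u := by
  obtain ⟨w, a, h⟩ := exists_common_denom (fun i => ((v i).toAdd : ℚ)) fun i => (v i).toAdd.2
  obtain ⟨k, w', hk⟩ := denom_consSeq_eq q g w
  have hne : (q : ℚ) ^ k ≠ 0 := pow_ne_zero _ (by exact_mod_cast hq.ne')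
  refine ⟨k, fun i => Multiplicative.ofAdd ⟨(v i).toAdd * q ^ k, w', a i, ?_⟩, funext fun i => ?_⟩
  · rw [← h i, hk]
    push_cast
    ring
  · apply Multiplicative.toAdd.injective
    apply Subtype.ext
    exact (mul_div_cancel_right₀ _ hne).symm

/-- The isomorphism need not fix the number `1`, but every element of the source is divisible by all
powers of `q`, in particular the preimage of `1`. -/
theorem mem_PInf_of_equiv {q : ℕ} (hq : q.Prime) {g : ℕ → ℕ} {G : AddSubgroup ℚ}
    (h1 : (1 : ℚ) ∈ G)
    (e : groupLang.Equiv (Multiplicative (fractions (consSeq q g))) (Multiplicative G)) :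
    q ∈ PInf G := by
  have he : ∀ x y, e (x * y) = e x * e y := fun x y =>
    e.map_fun (n := 2) GroupFunc.mul ![x, y]
  let f : Multiplicative (fractions (consSeq q g)) →* Multiplicative G := MonoidHom.mk' e he
  refine ⟨hq, fun k => ?_⟩
  have hne : (q : ℚ) ≠ 0 := by exact_mod_cast hq.ne_zero
  obtain ⟨x, hx⟩ := e.surjective (Multiplicative.ofAdd ⟨1, h1⟩)
  have hy : ∃ y : Multiplicative (fractions (consSeq q g)), y ^ q ^ k = x := by
    obtain ⟨w, a, h⟩ := x.toAdd.2
    refine ⟨Multiplicative.ofAdd ⟨(x.toAdd : ℚ) / q ^ k, List.replicate k 0 ++ w, a, ?_⟩, ?_⟩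
    · rw [denom_append, denom_consSeq_replicate, ← h]
      push_cast
      field_simp
    · apply Multiplicative.toAdd.injective
      apply Subtype.ext
      rw [toAdd_pow]
      simp only [toAdd_ofAdd, AddSubgroup.coe_nsmul, nsmul_eq_mul]
      push_cast
      field_simp
  obtain ⟨y, rfl⟩ := hy
  refine ⟨(e y).toAdd, (e y).toAdd.2, ?_⟩
  have h2 : (e y) ^ q ^ k = Multiplicative.ofAdd ⟨1, h1⟩ := hx ▸ (map_pow f y (q ^ k)).symm
  have h3 := congrArg (fun z : Multiplicative G => (z.toAdd : ℚ)) h2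
  simpa using h3

end GroupScott

-- The contradiction from inverting a prime outside `P^∞(G)`.

theorem mainTheorem10 (X : Set ℕ) (hce : REPred fun i => i ∈ X)
    (hnc : ¬ ComputablePred fun i => i ∈ X) (G : AddSubgroup ℚ) (h1 : (1 : ℚ) ∈ G)
    (hinf : GroupScott.PInf G = {p | ∃ i ∈ X, p = Nat.nth Nat.Prime i})
    (hfin : GroupScott.PFin G = ∅) :
    ¬ ∃ φ : GroupScott.InfSentence, GroupScott.IsComputableDSigma 2 φ ∧
      GroupScott.IsPseudoScottSentence (Multiplicative G) φ := by
  open GroupScott in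
  rintro ⟨φ, ⟨σ, π, ⟨e₁, rfl⟩, ⟨e₂, rfl⟩, rfl⟩, hφ⟩
  obtain ⟨g, hg, hgX, hXg⟩ := exists_enumeration hce
  have hpos : ∀ n, 0 < g n := fun n => by
    rcases hgX n with h | ⟨i, -, h⟩
    · omega
    · exact h ▸ (Nat.prime_nth_prime i).pos
  have hG : G = fractions g := by
    refine eq_fractions h1 hfin (fun n => ?_) ?_
    · rw [hinf]
      exact hgX n
    · rw [hinf]
      rintro p ⟨i, hi, rfl⟩
      exact hXg i hi
  have hprime : ∀ i, 0 < Nat.nth Nat.Prime i := fun i => (Nat.prime_nth_prime i).pos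
  have hmodels : Models (Multiplicative (fractions g))
      (.and (sigmaFormula 2 0 e₁) (piFormula 2 0 e₂)) := by
    -- The hypothesis on `φ` speaks only of computable structures, so truth in `G` is obtained
    -- through a computable copy.
    obtain ⟨B, ⟨e⟩⟩ := exists_computable_copy_fractions hg hpos
    subst hG
    exact models_of_equiv e ((hφ B).2 ⟨e⟩)
  obtain ⟨hσ, hπ⟩ := hmodels
  -- A prime outside `P^∞(G)` can be added without affecting the truth of the `Σ_2` sentence.
  obtain ⟨i, hiX, hi⟩ : ∃ i ∉ X, Models
      (Multiplicative (fractions (consSeq (Nat.nth Nat.Prime i) g))) (sigmaFormula 2 0 e₁) := by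
    change (sigmaFormula 2 0 e₁).Realize _ at hσ
    simp only [Models, realize_sigmaFormula_succ] at hσ ⊢
    obtain ⟨r, hr, hl, c, hc⟩ := hσ
    -- With exponent `0` the embedding is the inclusion, so the witness is the same tuple of
    -- rationals for every `i`.
    have key : ∃ i ∉ X, (piFormula (level r) (0 + tupleLength r) (subIndex r)).Realize
        (divPowEmbedding (hprime i) g 0 ∘ Fin.append Fin.elim0 c) := by
      obtain hl | hl : level r = 0 ∨ level r = 1 := by omega
      -- A quantifier-free matrix survives for any `i ∉ X`, and one exists since `X`, not being
      -- computable, is not all of `ℕ`.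
      · obtain ⟨i, hi⟩ : ∃ i, i ∉ X := by
          by_contra! h
          refine hnc ⟨fun i => .isTrue (h i), (Computable.const true).of_eq fun i => ?_⟩
          simp [h i]
        refine ⟨i, hi, ?_⟩
        rw [hl, piFormula_zero] at hc ⊢
        rwa [realize_decodeQF_embedding]
      · rw [hl] at hc ⊢
        obtain ⟨w₀, a, ha⟩ := exists_common_denom
          (fun k => ((Fin.append Fin.elim0 c k).toAdd : ℚ))
          fun k => (Fin.append Fin.elim0 c k).toAdd.2
        let Z := List.ofFn fun k => ((a k).toNat, (-a k).toNat)
        have hR (i : ℕ) := exists_refutes_iff hpos (subIndex r) w₀ (Z := Z) List.length_ofFn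
          (hprime i) (divPowEmbedding (hprime i) g 0 ∘ Fin.append Fin.elim0 c) (by
            intro k
            change ((Fin.append Fin.elim0 c k).toAdd : ℚ) / _ ^ 0 * _ = _
            rw [pow_zero, div_one, ha,
              List.getD_eq_getElem _ _ (k.2.trans_eq List.length_ofFn.symm)]
            simp [pairToInt])
        by_contra! hno
        classical
        -- Under `hno`, refutability after inverting the `i`-th prime enumerates the complement of
        -- `X`.
        refine hnc (ComputablePred.computable_iff_re_compl_re.2 ⟨hce, ?_⟩)
        have hre : REPred fun i => ∃ T, refutes g (subIndex r) Z (denom g w₀)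
            (Nat.nth Nat.Prime i) T = true :=
          REPred.exists_primcodable ((computable_refutes hg _ _ _).comp
            (computable_nthPrime.comp .fst) .snd)
        refine hre.of_eq fun i => ?_
        rw [hR i]
        -- For `i ∈ X` the group is unchanged, so the `Π_1` formula stays true there.
        refine ⟨fun h hiX => h ?_, hno i⟩
        obtain ⟨n, hn⟩ := hXg i hiX
        exact (realize_equiv (divPowEquiv (hprime i) hn) _ _).2 hc
    obtain ⟨i, hiX, hi⟩ := key
    refine ⟨i, hiX, r, hr, hl, divPowEmbedding (hprime i) g 0 ∘ c, ?_⟩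
    rwa [← append_comp, Subsingleton.elim (_ ∘ Fin.elim0) Fin.elim0] at hi
  have hπ' := models_piFormula_two (divPowEmbedding (hprime i) g)
    (exists_eq_divPow (hprime i) g) e₂ hπ
  obtain ⟨B, ⟨e⟩⟩ := exists_computable_copy_fractions
    (g := consSeq (Nat.nth Nat.Prime i) g) ((primrec_consSeq hg).comp (.const _) .id)
    (consSeq_pos (hprime i) hpos)
  obtain ⟨e'⟩ := (hφ B).1 (models_of_equiv e.symm ⟨hi, hπ'⟩)
  have hmem := mem_PInf_of_equiv (Nat.prime_nth_prime i) h1 (e'.comp e.symm)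
  rw [hinf] at hmem
  obtain ⟨j, hj, hij⟩ := hmem
  rw [Nat.nth_injective Nat.infinite_setOfPred_prime hij] at hiX
  exact hiX hj
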